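/- There is an absolute constant $C > 0$ such that the following holds. Let $B$ be a set of $n$ complex numbers and let $B.B = \{bb' : b, b' \in B\}$ be its product set. Then every arithmetic progression $r, r+d, \ldots, r+(N-1)d$ with $r, d \in \mathbb{C}$ and $d \neq 0$ that is contained in $B.B$ has length $N \leq C n^{3/2}$. -/

import Mathlib

open scoped Pointwise

/-- `S` contains a (nontrivial) arithmetic progression of length `N`: there are a first term `r`
and a nonzero common difference `d` such that the `N` (pairwise distinct) numbers
`r, r + d, …, r + (N - 1) d` all lie in `S`. -/
def ContainsAP (S : Set ℂ) (N : ℕ) : Prop :=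
  ∃ r d : ℂ, d ≠ 0 ∧ ∀ i : ℕ, i < N → r + (i : ℂ) * d ∈ S

/-!
Scaling `B` by a square root of `c` scales the product set by `c`, so the progression may be taken
to be `r, r + 1, …, r + (N - 1)`. Write each term as a product of two elements of `B`, and regard
these pairs as the edges of a bipartite graph on two copies of `B`.

If `r` is irrational, the progression is a multiplicative Sidon set: a coincidence
`(r + i)(r + j) = (r + k)(r + l)` is a linear equation for `r` over `ℚ`, hence trivial. So the graph
contains no 4-cycle, and double counting of paths of length two gives `N ^ 2 ≤ n ^ 3 + n N`
(`sq_le_of_irrational_ap`).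

If `r` is rational, a further scaling and the choice of a half of constant sign lead to positive
integers `p + i q` with `p` and `q` coprime. All of them lie in the multiplicative group generated
by `B`, so at most `n` of them are multiplicatively independent
(`card_le_of_private_prime_factors`). On the other hand, pass to a subprogression of `M = 4 ^ k`
terms and difference divisible by `2 ^ k`, where `M` is comparable to `N ^ (2 / 3)`; its difference
`q` then satisfies `M ≤ q ^ 2`. An argument in the style of Sylvester and Erdős shows that a positive
proportion of these terms have a prime factor `≥ M`, which no other term shares: up to one exceptional
term for each prime below `M`, the product of the remaining terms divides `(M - 1)!`, which is
impossible for so large a difference unless few terms remain (`le_card_largePrimeIndices`).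
The number of primes below `M` is at most `4 M / 15 + O(1)`, small enough for this to leave a positive
proportion. Hence `M = O(n)`.
-/

/-! ### Scaling the product set -/

theorem exists_card_eq_smul_mem_mul (B : Finset ℂ) {c : ℂ} (hc : c ≠ 0) :
    ∃ B' : Finset ℂ, B'.card = B.card ∧
      ∀ x ∈ (B : Set ℂ) * (B : Set ℂ), c * x ∈ (B' : Set ℂ) * (B' : Set ℂ) := by
  obtain ⟨w, hw⟩ := IsAlgClosed.exists_pow_nat_eq c (n := 2) two_pos
  have hw0 : w ≠ 0 := by rintro rfl; simp at hw; exact hc hw.symm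
  refine ⟨B.image (w * ·), Finset.card_image_of_injective _ (mul_right_injective₀ hw0), ?_⟩
  rintro _ ⟨x, hx, y, hy, rfl⟩
  refine ⟨w * x, Finset.mem_coe.2 (Finset.mem_image_of_mem _ hx), w * y,
    Finset.mem_coe.2 (Finset.mem_image_of_mem _ hy), ?_⟩
  simp only [← hw]; ring

/-! ### Multiplicative rank of a product set -/

theorem padicValRat_prod_zpow {ι : Type*} (p : ℕ) [Fact p.Prime] (s : Finset ι) (a : ι → ℚ)
    (c : ι → ℤ) (ha : ∀ i ∈ s, a i ≠ 0) :
    padicValRat p (∏ i ∈ s, a i ^ c i) = ∑ i ∈ s, c i * padicValRat p (a i) := by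
  classical
  induction s using Finset.induction_on with
  | empty => simp
  | insert i s hi ih =>
    have h1 : a i ^ c i ≠ 0 := zpow_ne_zero _ (ha i (Finset.mem_insert_self i s))
    have h2 : ∏ j ∈ s, a j ^ c j ≠ 0 := Finset.prod_ne_zero_iff.2 fun j hj =>
      zpow_ne_zero _ (ha j (Finset.mem_insert_of_mem hj))
    rw [Finset.prod_insert hi, Finset.sum_insert hi, padicValRat.mul h1 h2, padicValRat.zpow,
      ih fun j hj => ha j (Finset.mem_insert_of_mem hj)]

/-- The integers `a i`, each with a prime factor not shared with the others, are multiplicatively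
independent, whereas the elements of `B * B` generate a group of rank at most `B.card`. Concretely,
the exponent vectors in `B → ℤ` of factorizations of the `a i` over `B` are linearly independent. -/
theorem card_le_of_private_prime_factors (B : Finset ℂ) (T : Finset ℕ) (a : ℕ → ℕ)
    (ha : ∀ i ∈ T, a i ≠ 0)
    (hp : ∀ i ∈ T, ∃ p : ℕ, p.Prime ∧ p ∣ a i ∧ ∀ j ∈ T, j ≠ i → ¬ p ∣ a j)
    (hB : ∀ i ∈ T, (a i : ℂ) ∈ (B : Set ℂ) * (B : Set ℂ)) : T.card ≤ B.card := by
  classical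
  choose! f hf g hg hfg using hB
  simp only at hfg
  -- Replacing `0` by `1` makes all the integer powers below multiplicative in the exponent.
  let u : ℂ → ℂ := fun b => if b = 0 then 1 else b
  have hu : ∀ b, u b ≠ 0 := fun b => by
    by_cases h : b = 0 <;> simp [u, h]
  have huf : ∀ i ∈ T, u (f i) * u (g i) = a i := fun i hi => by
    have h0 : f i * g i ≠ 0 := by rw [hfg i hi]; exact_mod_cast ha i hi
    simp only [u, left_ne_zero_of_mul h0, right_ne_zero_of_mul h0, if_false]
    exact hfg i hi
  -- The exponent vector of the factorization `a i = f i * g i`; if `f i = g i`, the entry is `2`.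
  let v : T → B → ℤ := fun i b => (if (b : ℂ) = f i then 1 else 0) + if (b : ℂ) = g i then 1 else 0
  have hv : ∀ i : T, ∏ b : B, u b ^ v i b = a i := fun i => by
    have key : ∀ x ∈ B, ∏ b : B, u b ^ (if (b : ℂ) = x then (1 : ℤ) else 0) = u x := fun x hx => by
      rw [Finset.prod_eq_single (⟨x, hx⟩ : B)]
      · simp
      · intro b _ hb
        rw [if_neg fun h => hb (Subtype.ext h), zpow_zero]
      · simp
    simp only [v, zpow_add₀ (hu _), Finset.prod_mul_distrib]
    rw [key _ (hf i i.2), key _ (hg i i.2), huf i i.2]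
  have hlin : LinearIndependent ℤ v := by
    rw [Fintype.linearIndependent_iff]
    intro c hc i
    have h1 : ∏ j : T, (a j : ℂ) ^ c j = 1 := by
      have h : ∀ b : B, ∏ j : T, (u b ^ v j b) ^ c j = 1 := fun b => by
        have hb := congrFun hc b
        simp only [Finset.sum_apply, Pi.smul_apply, smul_eq_mul, Pi.zero_apply] at hb
        have hpow : ∀ s : Finset T, ∏ j ∈ s, (u b ^ v j b) ^ c j = u b ^ ∑ j ∈ s, c j * v j b := by
          intro s
          induction s using Finset.induction_on with
          | empty => simp
          | insert j s hj ih =>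
            rw [Finset.prod_insert hj, Finset.sum_insert hj, ih, ← zpow_mul (u b) (v j b),
              ← zpow_add₀ (hu b), mul_comm (v j b)]
        rw [hpow, hb, zpow_zero]
      calc ∏ j : T, (a j : ℂ) ^ c j = ∏ j : T, ∏ b : B, (u b ^ v j b) ^ c j := by
            refine Finset.prod_congr rfl fun j _ => ?_
            rw [Finset.prod_zpow, hv]
        _ = 1 := by
            rw [Finset.prod_comm]
            exact Finset.prod_eq_one fun b _ => h b
    have h2 : ∏ j : T, (a j : ℚ) ^ c j = 1 := by
      apply Rat.cast_injective (α := ℂ)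
      push_cast
      exact h1
    -- Only the `i`-th factor contributes to the valuation at the prime private to `a i`.
    obtain ⟨p, hpp, hpi, hpj⟩ := hp i i.2
    have := Fact.mk hpp
    have h3 := congrArg (padicValRat p) h2
    rw [padicValRat_prod_zpow _ _ _ _ fun j _ => by exact_mod_cast ha j j.2, padicValRat.one,
      Finset.sum_eq_single i] at h3
    · rcases mul_eq_zero.1 h3 with h | h
      · exact h
      · rw [padicValRat.of_nat] at h
        have := (dvd_iff_padicValNat_ne_zero (ha i i.2)).1 hpi
        exact absurd (by exact_mod_cast h) this
    · intro j _ hj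
      rw [padicValRat.of_nat,
        padicValNat.eq_zero_of_not_dvd (hpj j j.2 fun h => hj (Subtype.ext h))]
      simp
    · simp
  simpa using hlin.fintype_card_le_finrank

/-! ### Irrational progressions -/

/-- The factorizations of the terms over `B` are the edges of a bipartite graph without 4-cycles;
the bound is the Kővári–Sós–Turán count for such a graph. -/
theorem sq_le_of_irrational_ap (B : Finset ℂ) (r : ℂ) (hr : ∀ x : ℚ, r ≠ x) (N : ℕ)
    (h : ∀ i < N, r + i ∈ (B : Set ℂ) * (B : Set ℂ)) :
    N ^ 2 ≤ B.card ^ 3 + B.card * N := by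
  classical
  choose! f hf g hg hfg using h
  simp only at hfg
  -- A coincidence between products of terms is trivial, as otherwise it makes `r` rational.
  have hsidon : ∀ i j k l : ℕ, (r + i) * (r + j) = (r + k) * (r + l) → i = k ∨ i = l := by
    intro i j k l e
    have e' : ((i + j - k - l : ℚ) : ℂ) * r = ((k * l - i * j : ℚ) : ℂ) := by
      push_cast; linear_combination e
    by_cases hs : (i + j - k - l : ℚ) = 0
    · rw [hs] at e'
      have e2 : (k * l - i * j : ℚ) = 0 := by
        have : ((k * l - i * j : ℚ) : ℂ) = 0 := by rw [← e']; simp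
        exact_mod_cast this
      have : ((i : ℚ) - k) * (i - l) = 0 := by
        linear_combination (i : ℚ) * hs + e2
      rcases mul_eq_zero.1 this with h | h
      · left; exact_mod_cast sub_eq_zero.1 h
      · right; exact_mod_cast sub_eq_zero.1 h
    · refine absurd ?_ (hr ((k * l - i * j) / (i + j - k - l)))
      have hs' : ((i + j - k - l : ℚ) : ℂ) ≠ 0 := by exact_mod_cast hs
      rw [Rat.cast_div, eq_div_iff hs', mul_comm, e']
  have hinj : ∀ i < N, ∀ j < N, f i = f j → g i = g j → i = j := by
    intro i hi j hj h1 h2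
    have := hfg i hi
    rw [h1, h2, hfg j hj] at this
    exact_mod_cast (add_left_cancel this).symm
  -- The edges with left end `x`.
  let F : ℂ → Finset ℕ := fun x => (Finset.range N).filter (f · = x)
  have hsum : ∑ x ∈ B, (F x).card = N := by
    rw [← Finset.card_eq_sum_card_fiberwise (fun i hi => hf i (by simpa using hi)),
      Finset.card_range]
  have hcount : ∑ x ∈ B, (F x).card ^ 2 ≤ B.card ^ 2 + N := by
    -- The pairs of edges with a common left end.
    let P : Finset (ℕ × ℕ) :=
      (Finset.range N ×ˢ Finset.range N).filter fun z => f z.1 = f z.2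
    have h1 : ∑ x ∈ B, (F x).card ^ 2 = P.card := by
      rw [Finset.card_eq_sum_card_fiberwise (t := B) (f := fun z => f z.1)
        (fun z hz => hf z.1 (by simp [P] at hz; exact hz.1.1))]
      refine Finset.sum_congr rfl fun x _ => ?_
      rw [sq, ← Finset.card_product]
      congr 1
      ext ⟨i, j⟩
      simp only [F, P, Finset.mem_product, Finset.mem_filter, Finset.mem_range]
      constructor
      · rintro ⟨⟨a, rfl⟩, b, c⟩; exact ⟨⟨⟨a, b⟩, c.symm⟩, rfl⟩
      · rintro ⟨⟨⟨a, b⟩, c⟩, d⟩; exact ⟨⟨a, d⟩, b, c ▸ d⟩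
    -- An off-diagonal pair of edges with a common left end is determined by its right ends.
    have h2 : (P.filter fun z => z.1 ≠ z.2).card ≤ (B ×ˢ B).card := by
      refine Finset.card_le_card_of_injOn (fun z => (g z.1, g z.2)) ?_ ?_
      · intro z hz
        simp [P] at hz
        simpa using ⟨hg _ hz.1.1.1, hg _ hz.1.1.2⟩
      · rintro ⟨i, j⟩ hz ⟨k, l⟩ hw e
        simp [P] at hz hw
        simp only [Prod.mk.injEq] at e
        obtain ⟨⟨⟨hi, hj⟩, hij⟩, hne⟩ := hz
        obtain ⟨⟨⟨hk, hl⟩, hkl⟩, -⟩ := hw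
        have e1 : (r + i) * (r + l) = (r + j) * (r + k) := by
          rw [← hfg i hi, ← hfg j hj, ← hfg k hk, ← hfg l hl, hij, hkl, e.1, e.2]; ring
        have hik : i = k := (hsidon _ _ _ _ e1).resolve_left hne
        subst hik
        exact Prod.ext rfl (hinj j hj l hl (hij.symm.trans hkl) e.2)
    have h3 : (P.filter fun z => ¬ z.1 ≠ z.2).card ≤ N := by
      calc _ ≤ (Finset.range N).card := by
            refine Finset.card_le_card_of_injOn Prod.fst ?_ ?_
            · intro z hz; simp [P] at hz; simpa using hz.1.1.1
            · rintro ⟨i, j⟩ hz ⟨k, l⟩ hw e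
              simp at hz hw e
              ext <;> simp [← hz.2, ← hw.2, e]
        _ = N := Finset.card_range N
    rw [h1, ← Finset.card_filter_add_card_filter_not (fun z : ℕ × ℕ => z.1 ≠ z.2)]
    rw [Finset.card_product] at h2
    nlinarith
  calc N ^ 2 = (∑ x ∈ B, (F x).card) ^ 2 := by rw [hsum]
    _ ≤ B.card * ∑ x ∈ B, (F x).card ^ 2 := sq_sum_le_card_mul_sum_sq
    _ ≤ B.card * (B.card ^ 2 + N) := Nat.mul_le_mul_left _ hcount
    _ = _ := by ring

/-! ### Large prime factors in integer progressions -/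

theorem dvd_natAbs_sub_of_dvd_of_dvd {p q d i j : ℕ} (hpq : p.Coprime q) (hi : d ∣ p + i * q)
    (hj : d ∣ p + j * q) : d ∣ ((i : ℤ) - j).natAbs := by
  have hc : d.Coprime q :=
    Nat.Coprime.coprime_dvd_left hi ((Nat.coprime_add_mul_right_left p q i).2 hpq)
  have h : (d : ℤ) ∣ ((i : ℤ) - j) * q := by
    rw [show ((i : ℤ) - j) * q = ((p + i * q : ℕ) : ℤ) - ((p + j * q : ℕ) : ℤ) by push_cast; ring]
    exact dvd_sub (Int.natCast_dvd_natCast.2 hi) (Int.natCast_dvd_natCast.2 hj)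
  have hc' : IsCoprime (d : ℤ) q := Nat.isCoprime_iff_coprime.2 hc
  exact Int.natCast_dvd.1 (hc'.dvd_of_dvd_mul_right h)

theorem prod_natAbs_sub_dvd_factorial {m M : ℕ} (hm : m < M) :
    ∏ i ∈ (Finset.range M).erase m, ((i : ℤ) - m).natAbs ∣ (M - 1).factorial := by
  have hsplit : (Finset.range M).erase m = Finset.range m ∪ Finset.Ico (m + 1) M := by
    ext i; simp only [Finset.mem_erase, Finset.mem_range, Finset.mem_union, Finset.mem_Ico]; omega
  have hdisj : Disjoint (Finset.range m) (Finset.Ico (m + 1) M) := by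
    rw [Finset.disjoint_left]; intro i; simp only [Finset.mem_range, Finset.mem_Ico]; omega
  have h1 : ∏ i ∈ Finset.range m, ((i : ℤ) - m).natAbs = m.factorial := by
    rw [← Finset.prod_range_add_one_eq_factorial, ← Finset.prod_range_reflect]
    refine Finset.prod_congr rfl fun i hi => ?_
    have := Finset.mem_range.1 hi
    omega
  have h2 : ∏ i ∈ Finset.Ico (m + 1) M, ((i : ℤ) - m).natAbs = (M - 1 - m).factorial := by
    rw [← Finset.prod_range_add_one_eq_factorial, Finset.prod_Ico_eq_prod_range,
      show M - (m + 1) = M - 1 - m by omega]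
    refine Finset.prod_congr rfl fun i hi => ?_
    omega
  rw [hsplit, Finset.prod_union hdisj, h1, h2]
  have := Nat.factorial_mul_factorial_dvd_factorial (n := M - 1) (k := m) (by omega)
  exact this

/-- Erdős's argument: for each prime `l < M`, discard a term with the largest `l`-adic valuation, at
index `m`. The valuation of any other term is at most that of `i - m`, and the product of all the
differences `|i - m|` divides `(M - 1)!`. -/
theorem exists_prod_dvd_factorial {p q M : ℕ} (hpq : p.Coprime q) (hp : 0 < p) {U : Finset ℕ}
    (hUM : U ⊆ Finset.range M) (hU : ∀ i ∈ U, ∀ l : ℕ, l.Prime → l ∣ p + i * q → l < M) :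
    ∃ R : Finset ℕ, R.card ≤ M.primeCounting' ∧
      ∏ i ∈ U \ R, (p + i * q) ∣ (M - 1).factorial := by
  classical
  rcases U.eq_empty_or_nonempty with rfl | hne
  · exact ⟨∅, by simp, by simp⟩
  choose m hmU hmax using fun l : ℕ =>
    Finset.exists_max_image U (fun i => (p + i * q).factorization l) hne
  have ha : ∀ i, p + i * q ≠ 0 := fun i => by omega
  refine ⟨(Nat.primesBelow M).image m, ?_, ?_⟩
  · rw [← Nat.primesBelow_card_eq_primeCounting']; exact Finset.card_image_le
  rw [← Nat.factorization_prime_le_iff_dvd (Finset.prod_ne_zero_iff.2 fun i _ => ha i)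
    (Nat.factorial_ne_zero _)]
  intro l hl
  rw [Nat.factorization_prod fun i _ => ha i, Finset.sum_apply']
  rcases lt_or_ge l M with hlM | hlM
  · have hne' : ∀ i ∈ (Finset.range M).erase (m l), ((i : ℤ) - m l).natAbs ≠ 0 := fun i hi => by
      have := Finset.ne_of_mem_erase hi; omega
    have hsub : U \ (Nat.primesBelow M).image m ⊆ (Finset.range M).erase (m l) := by
      intro i hi
      rw [Finset.mem_sdiff] at hi
      refine Finset.mem_erase.2 ⟨?_, hUM hi.1⟩
      rintro rfl
      exact hi.2 (Finset.mem_image_of_mem m (Nat.mem_primesBelow.2 ⟨hlM, hl⟩))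
    calc ∑ i ∈ U \ (Nat.primesBelow M).image m, (p + i * q).factorization l
        ≤ ∑ i ∈ U \ (Nat.primesBelow M).image m, ((i : ℤ) - m l).natAbs.factorization l := by
          refine Finset.sum_le_sum fun i hi => ?_
          have hi0 := hne' i (hsub hi)
          rw [← hl.pow_dvd_iff_le_factorization hi0]
          -- By maximality of the valuation at `m l`, the power of `l` in the `i`-th term divides both.
          exact dvd_natAbs_sub_of_dvd_of_dvd hpq (Nat.ordProj_dvd _ _)
            ((pow_dvd_pow l (hmax l i (Finset.mem_sdiff.1 hi).1)).trans (Nat.ordProj_dvd _ _))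
      _ ≤ ∑ i ∈ (Finset.range M).erase (m l), ((i : ℤ) - m l).natAbs.factorization l :=
          Finset.sum_le_sum_of_subset hsub
      _ = (∏ i ∈ (Finset.range M).erase (m l), ((i : ℤ) - m l).natAbs).factorization l := by
          rw [Nat.factorization_prod hne', Finset.sum_apply']
      _ ≤ (M - 1).factorial.factorization l :=
          (Nat.factorization_le_iff_dvd (Finset.prod_ne_zero_iff.2 hne')
            (Nat.factorial_ne_zero _)).2
            (prod_natAbs_sub_dvd_factorial (Finset.mem_range.1 (hUM (hmU l)))) l
  · rw [Finset.sum_eq_zero]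
    · exact Nat.zero_le _
    · intro i hi
      refine Nat.factorization_eq_zero_of_not_dvd fun h => ?_
      exact absurd (hU i (Finset.mem_sdiff.1 hi).1 l hl h) (by omega)

/-- Compare each term `p + i * q` with `i * q` and cancel the factors `i` with `i ∈ W` from the
factorial. -/
theorem pow_card_le_pow_of_prod_le_factorial {p q M : ℕ} {W : Finset ℕ}
    (hW : W ⊆ Finset.Ico 1 M) (h : ∏ i ∈ W, (p + i * q) ≤ (M - 1).factorial) :
    q ^ W.card ≤ M ^ (M - 1 - W.card) := by
  have hpos : 0 < ∏ i ∈ W, i := Finset.prod_pos fun i hi => (Finset.mem_Ico.1 (hW hi)).1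
  refine Nat.le_of_mul_le_mul_right ?_ hpos
  calc q ^ W.card * ∏ i ∈ W, i = ∏ i ∈ W, q * i := by
        rw [Finset.prod_mul_distrib, Finset.prod_const]
    _ ≤ ∏ i ∈ W, (p + i * q) :=
        Finset.prod_le_prod' fun i _ => by rw [mul_comm]; exact Nat.le_add_left _ _
    _ ≤ (M - 1).factorial := h
    _ ≤ M ^ (M - 1 - W.card) * ∏ i ∈ W, i := by
        rcases M with _ | M
        · have : W = ∅ := by simpa using hW
          simp [this]
        · rw [Nat.add_sub_cancel, ← Finset.prod_Ico_id_eq_factorial, ← Finset.prod_sdiff hW]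
          refine Nat.mul_le_mul_right _ ?_
          refine (Finset.prod_le_pow_card _ _ (M + 1) fun i hi => ?_).trans_eq ?_
          · exact (Finset.mem_Ico.1 (Finset.mem_sdiff.1 hi).1).2.le
          · rw [Finset.card_sdiff_of_subset hW]; simp

open Classical in
/-- The indices `i < M` such that `p + i * q` has a prime factor that is at least `M`. When `p` and
`q` are coprime, such a prime divides no other term `p + j * q` with `j < M`. -/
noncomputable def largePrimeIndices (p q M : ℕ) : Finset ℕ :=
  (Finset.range M).filter fun i => ∃ l : ℕ, l.Prime ∧ M ≤ l ∧ l ∣ p + i * q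

theorem le_card_largePrimeIndices {p q M : ℕ} (hpq : p.Coprime q) (hp : 0 < p)
    (hq : 2 ≤ q) (hM : M ≤ q ^ 2) :
    M ≤ 3 * ((largePrimeIndices p q M).card +
      M.primeCounting') + 1 := by
  classical
  set T := largePrimeIndices p q M with hT
  obtain ⟨R, hR, hdvd⟩ := exists_prod_dvd_factorial hpq hp (M := M) (U := Finset.range M \ T)
    Finset.sdiff_subset fun i hi l hl hli => by
      by_contra! hlM
      rw [Finset.mem_sdiff] at hi
      exact hi.2 (Finset.mem_filter.2 ⟨hi.1, l, hl, hlM, hli⟩)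
  set V := (Finset.range M \ T) \ R with hV
  -- The comparison of terms with `i * q` is void at `i = 0`, so this index is dropped.
  have hsub : V.erase 0 ⊆ Finset.Ico 1 M := fun i hi => by
    simp only [hV, Finset.mem_erase, Finset.mem_sdiff, Finset.mem_range] at hi
    simp only [Finset.mem_Ico]; omega
  have hpow := pow_card_le_pow_of_prod_le_factorial (p := p) (q := q) hsub
    ((Nat.le_of_dvd (Nat.factorial_pos _)
      ((Finset.prod_dvd_prod_of_subset _ _ _ (Finset.erase_subset _ _)).trans hdvd)))
  have h2 := hpow.trans (Nat.pow_le_pow_left hM _)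
  rw [← pow_mul, Nat.pow_le_pow_iff_right (by omega)] at h2
  -- Now `h2` says that `w ≤ 2 * (M - 1 - w)` for `w` the number of indices left.
  have h3 := Finset.pred_card_le_card_erase (s := V) (a := 0)
  have h4 : M ≤ V.card + R.card + T.card := by
    have : Finset.range M ⊆ (V ∪ R) ∪ T := fun i hi => by
      simp only [hV, Finset.mem_union, Finset.mem_sdiff]; tauto
    calc M = (Finset.range M).card := (Finset.card_range M).symm
      _ ≤ _ := (Finset.card_le_card this).trans
        ((Finset.card_union_le _ _).trans (Nat.add_le_add_right (Finset.card_union_le _ _) _))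
  omega

/-- Counting residues coprime to `30` bounds the density of the primes by `8 / 30`. Any density below
`1 / 3` suffices below. -/
theorem primeCounting'_le (M : ℕ) : 30 * M.primeCounting' ≤ 8 * M + 540 := by
  have h10 : Nat.primeCounting' 31 = 10 := by decide
  have h8 : Nat.totient 30 = 8 := by decide
  have h := Nat.primeCounting'_add_le (a := 30) (k := 31) (by norm_num) (by norm_num) M
  have hmono := Nat.monotone_primeCounting' (Nat.le_add_left M 31)
  rw [h10, h8] at h
  omega

/-! ### Rational progressions -/

theorem le_of_ap_sq_le (B : Finset ℂ) (hB : 0 < B.card) {p q M : ℕ} (hpq : p.Coprime q)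
    (hp : 0 < p) (hq : 2 ≤ q) (hM : M ≤ q ^ 2)
    (h : ∀ i < M, ((p + i * q : ℕ) : ℂ) ∈ (B : Set ℂ) * (B : Set ℂ)) :
    M ≤ 290 * B.card := by
  classical
  have h1 := le_card_largePrimeIndices hpq hp hq hM
  have h2 := primeCounting'_le M
  have h3 := card_le_of_private_prime_factors B
    (largePrimeIndices p q M)
    (fun i => p + i * q) (fun i _ => by omega) (fun i hi => by
      obtain ⟨hiM, l, hl, hMl, hli⟩ := Finset.mem_filter.1 hi
      refine ⟨l, hl, hli, fun j hj hji hlj => ?_⟩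
      have hjM := (Finset.mem_filter.1 hj).1
      rw [Finset.mem_range] at hiM hjM
      have := Nat.le_of_dvd (by omega) (dvd_natAbs_sub_of_dvd_of_dvd hpq hli hlj)
      omega)
    (fun i hi => h i (Finset.mem_range.1 (Finset.mem_filter.1 hi).1))
  omega

/-- Pass to a subprogression with step `2 ^ k` and `4 ^ k` terms, `8 ^ k ≤ H < 8 ^ (k + 1)`: its
difference is at least the square root of its length. -/
theorem sq_le_of_pos_ap (B : Finset ℂ) (hB : 0 < B.card) {p q H : ℕ} (hpq : p.Coprime q)
    (hp : 0 < p) (hq : 0 < q)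
    (h : ∀ i < H, ((p + i * q : ℕ) : ℂ) ∈ (B : Set ℂ) * (B : Set ℂ)) :
    H ^ 2 ≤ 64 * (290 * B.card) ^ 3 := by
  rcases lt_or_ge H 8 with hH | hH
  · have : 1 ≤ B.card ^ 3 := Nat.one_le_pow _ _ hB
    nlinarith
  obtain ⟨k, hk1, hk2⟩ : ∃ k, 8 ^ k ≤ H ∧ H < 8 ^ (k + 1) :=
    ⟨Nat.log 8 H, Nat.pow_log_le_self 8 (by omega), Nat.lt_pow_succ_log_self (by norm_num) H⟩
  have hk0 : k ≠ 0 := by rintro rfl; omega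
  -- Shift the first term so that it is odd, hence coprime to the new difference `2 ^ k * q`.
  obtain ⟨t, ht, hodd⟩ : ∃ t ≤ 1, (p + t * q).Coprime 2 := by
    by_cases hp2 : Odd p
    · exact ⟨0, by omega, by simpa using hp2.coprime_two_right⟩
    · refine ⟨1, le_rfl, Nat.Coprime.symm (Nat.coprime_two_left.2 ?_)⟩
      have hq2 : Odd q := by
        by_contra hq2
        rw [Nat.not_odd_iff_even] at hp2 hq2
        exact Nat.not_coprime_of_dvd_of_dvd one_lt_two hp2.two_dvd hq2.two_dvd hpq
      rw [one_mul]
      exact (Nat.not_odd_iff_even.1 hp2).add_odd hq2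
  have h2k : 2 ≤ 2 ^ k := Nat.le_self_pow hk0 2
  have h48 : 2 ^ k * 4 ^ k = 8 ^ k := by rw [← mul_pow]; norm_num
  have hM := le_of_ap_sq_le B hB (p := p + t * q) (q := 2 ^ k * q) (M := 4 ^ k)
    (Nat.Coprime.mul_right (hodd.pow_right k) ((Nat.coprime_add_mul_right_left p q t).2 hpq))
    (by omega) (by nlinarith)
    (by
      rw [mul_pow, ← pow_mul, mul_comm k, pow_mul]
      exact Nat.le_mul_of_pos_right _ (by positivity))
    fun i hi => by
      have : p + t * q + i * (2 ^ k * q) = p + (t + i * 2 ^ k) * q := by ring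
      rw [this]
      refine h _ ?_
      have : (i + 1) * 2 ^ k ≤ 4 ^ k * 2 ^ k := Nat.mul_le_mul_right _ hi
      nlinarith
  calc H ^ 2 ≤ (8 ^ (k + 1)) ^ 2 := Nat.pow_le_pow_left hk2.le 2
    _ = 64 * (4 ^ k) ^ 3 := by
        rw [← pow_mul, ← pow_mul, show (8 : ℕ) = 2 ^ 3 by norm_num,
          show (4 : ℕ) = 2 ^ 2 by norm_num,
          show (64 : ℕ) = 2 ^ 6 by norm_num, ← pow_mul, ← pow_mul, ← pow_add]
        congr 1; ring
    _ ≤ _ := by gcongr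

theorem sq_half_le_of_rational_ap (B : Finset ℂ) (hB : 0 < B.card) (r : ℚ) (N : ℕ)
    (h : ∀ i < N, (r : ℂ) + i ∈ (B : Set ℂ) * (B : Set ℂ)) :
    (N / 2) ^ 2 ≤ 64 * (290 * B.card) ^ 3 := by
  have hcop : IsCoprime r.num (r.den : ℤ) :=
    Int.isCoprime_iff_gcd_eq_one.2 r.reduced
  have hden : (r.den : ℂ) ≠ 0 := by exact_mod_cast r.den_ne_zero
  have hr : (r.den : ℂ) * r = r.num := by exact_mod_cast Rat.den_mul_eq_num r
  -- A run of `N / 2` terms of constant sign, read in the direction of increasing modulus.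
  rcases lt_or_ge 0 (r.num + (N / 2 : ℕ) * r.den) with hs | hs
  · obtain ⟨p, hp⟩ := Int.eq_ofNat_of_zero_le hs.le
    obtain ⟨B', hcard, hB'⟩ := exists_card_eq_smul_mem_mul B hden
    rw [← hcard]
    refine sq_le_of_pos_ap B' (hcard ▸ hB) (p := p) (q := r.den) ?_ (by omega) r.pos ?_
    · rw [← Nat.isCoprime_iff_coprime, ← hp]
      exact (IsCoprime.add_mul_right_left_iff).2 hcop
    · intro i hi
      have := hB' _ (h (N / 2 + i) (by omega))
      convert this using 1
      have hp' : (r.num : ℂ) + (N / 2 : ℕ) * r.den = p := by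
        simpa only [Int.cast_neg, Int.cast_add, Int.cast_mul, Int.cast_natCast] using
          congrArg (Int.cast : ℤ → ℂ) hp
      push_cast [← hp']
      linear_combination -hr
  · rcases Nat.eq_zero_or_pos (N / 2) with h0 | h0
    · simp [h0]
    obtain ⟨p, hp⟩ := Int.eq_ofNat_of_zero_le
      (a := -(r.num + (N / 2 - 1 : ℕ) * r.den)) (by
        have := r.pos
        push_cast [Nat.cast_sub h0] at hs ⊢; nlinarith)
    have hp0 : 0 < p := by
      have := r.pos
      push_cast [Nat.cast_sub h0] at hs hp
      zify; nlinarith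
    obtain ⟨B', hcard, hB'⟩ := exists_card_eq_smul_mem_mul B (neg_ne_zero.2 hden)
    rw [← hcard]
    refine sq_le_of_pos_ap B' (hcard ▸ hB) (p := p) (q := r.den) ?_ hp0 r.pos ?_
    · rw [← Nat.isCoprime_iff_coprime, ← hp]
      exact ((IsCoprime.add_mul_right_left_iff).2 hcop).neg_left
    · intro i hi
      have := hB' _ (h (N / 2 - 1 - i) (by omega))
      convert this using 1
      have hp' : -((r.num : ℂ) + (N / 2 - 1 : ℕ) * r.den) = p := by
        simpa only [Int.cast_neg, Int.cast_add, Int.cast_mul, Int.cast_natCast] using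
          congrArg (Int.cast : ℤ → ℂ) hp
      rw [Nat.cast_sub (by omega : i ≤ N / 2 - 1)]
      push_cast [← hp']
      linear_combination hr

theorem theorem3 :
    ∃ C : ℝ, 0 < C ∧ ∀ (n : ℕ) (B : Finset ℂ), B.card = n →
      ∀ N : ℕ, ContainsAP ((B : Set ℂ) * (B : Set ℂ)) N →
        (N : ℝ) ≤ C * (n : ℝ) ^ (3 / 2 : ℝ) := by
  refine ⟨10 ^ 6, by norm_num, ?_⟩
  rintro n B hn N ⟨r, d, hd, h⟩
  rcases Nat.eq_zero_or_pos n with rfl | hn0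
  · have hN : N = 0 := by
      by_contra hN
      have := h 0 (Nat.pos_of_ne_zero hN)
      rw [Finset.card_eq_zero] at hn
      simp [hn] at this
    rw [hN, Nat.cast_zero]
    positivity
  obtain ⟨B', hcard, hB'⟩ := exists_card_eq_smul_mem_mul B (inv_ne_zero hd)
  have hAP : ∀ i < N, r / d + i ∈ (B' : Set ℂ) * (B' : Set ℂ) := fun i hi => by
    have := hB' _ (h i hi)
    convert this using 1
    field_simp
  have hsq : N ^ 2 ≤ (10 ^ 6) ^ 2 * n ^ 3 := by
    by_cases hr : ∃ x : ℚ, r / d = x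
    · obtain ⟨x, hx⟩ := hr
      have hhalf := sq_half_le_of_rational_ap B' (by omega) x N (by rwa [← hx])
      rw [hcard, hn, mul_pow] at hhalf
      have h1 : N ≤ 2 * (N / 2) + 1 := by omega
      have hn3 : 1 ≤ n ^ 3 := Nat.one_le_pow _ _ hn0
      have h2 := Nat.pow_le_pow_left h1 2
      generalize N / 2 = m at *
      zify at *
      nlinarith [sq_nonneg ((m : ℤ) - 1)]
    · have := sq_le_of_irrational_ap B' (r / d) (fun x hx => hr ⟨x, hx⟩) N hAP
      rw [hcard, hn] at this
      have hn23 : n ^ 2 ≤ n ^ 3 := Nat.pow_le_pow_right hn0 (by norm_num)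
      have : (N : ℤ) ^ 2 ≤ n ^ 3 + n * N := by exact_mod_cast this
      zify at hn23 ⊢
      nlinarith [sq_nonneg ((N : ℤ) - n)]
  have hpow : ((n : ℝ) ^ (3 / 2 : ℝ)) ^ 2 = (n : ℝ) ^ 3 := by
    rw [← Real.rpow_natCast, ← Real.rpow_mul (Nat.cast_nonneg n), ← Real.rpow_natCast]
    norm_num
  refine le_of_sq_le_sq ?_ (by positivity)
  rw [mul_pow, hpow]
  exact_mod_cast hsq
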